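/- Let $(M^n,g)$ be a closed (compact, without boundary) smooth Riemannian manifold of dimension $n$, with Riemannian volume measure $\mu_g$, and let $k\ge 0$ be an integer. Let $\mathcal H^k_g(M)$ be the space of harmonic $k$-forms, i.e. of smooth real $k$-forms $\alpha$ with $(dd^*+d^*d)\alpha=0$, where $d^*$ is the formal $L^2$-adjoint of $d$; write $|\cdot|$ for the pointwise norm of forms induced by $g$ and $\|\alpha\|_{L^2}^2=\int_M|\alpha|^2\,d\mu_g$. Let $K$ be the Schwartz kernel of the $L^2$-orthogonal projection onto $\mathcal H^k_g(M)$, i.e. the continuous section $K(x,y)\in\operatorname{Hom}(\Lambda^kT_y^*M,\Lambda^kT_x^*M)$ over $M\times M$ such that, for every smooth $k$-form $\omega$, the form $x\mapsto\int_M K(x,y)\,\omega(y)\,d\mu_g(y)$ is the $L^2$-orthogonal projection of $\omega$ onto $\mathcal H^k_g(M)$. Then for every $x\in M$ the supremum below is finite, and \[ 0\le \operatorname{Tr}K(x,x)\le\binom nk\ \sup_{\alpha\in\mathcal H^k_g(M),\ \|\alpha\|_{L^2}=1}|\alpha(x)|^2 , \] where the supremum is $0$ if $\mathcal H^k_g(M)=0$.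 -/

import Mathlib

open scoped Manifold ContDiff

namespace HarmonicKernel

noncomputable section

variable {n : ℕ} {M : Type*} [TopologicalSpace M] [ChartedSpace (EuclideanSpace ℝ (Fin n)) M]

/-- The fibre `Λᵏ T*ₓM`: alternating `k`-linear forms on the tangent space at `x`. -/
abbrev FormAt (n k : ℕ) {M : Type*} [TopologicalSpace M]
    [ChartedSpace (EuclideanSpace ℝ (Fin n)) M] (x : M) : Type :=
  TangentSpace (𝓡 n) x [⋀^Fin k]→L[ℝ] ℝ

/-- (Not necessarily smooth) differential `k`-forms on `M`. -/
abbrev Form (n k : ℕ) (M : Type*) [TopologicalSpace M]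
    [ChartedSpace (EuclideanSpace ℝ (Fin n)) M] : Type _ :=
  (x : M) → FormAt n k x

/-- Smooth Riemannian metrics on `M`. -/
abbrev Metric (n : ℕ) (M : Type*) [TopologicalSpace M]
    [ChartedSpace (EuclideanSpace ℝ (Fin n)) M] [IsManifold (𝓡 n) ∞ M] : Type _ :=
  Bundle.ContMDiffRiemannianMetric (𝓡 n) ∞ (EuclideanSpace ℝ (Fin n))
    (fun x : M => TangentSpace (𝓡 n) x)

/-- Derivative at `u` of the inverse of the preferred chart at `p`. -/
def chartInvDeriv (p : M) (u : EuclideanSpace ℝ (Fin n)) :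
    EuclideanSpace ℝ (Fin n) →L[ℝ] TangentSpace (𝓡 n) ((extChartAt (𝓡 n) p).symm u) :=
  mfderiv 𝓘(ℝ, EuclideanSpace ℝ (Fin n)) (𝓡 n) (extChartAt (𝓡 n) p).symm u

/-- Derivative at `p` of the preferred chart at `p`. -/
def chartDeriv (p : M) : TangentSpace (𝓡 n) p →L[ℝ] EuclideanSpace ℝ (Fin n) :=
  mfderiv (𝓡 n) 𝓘(ℝ, EuclideanSpace ℝ (Fin n)) (extChartAt (𝓡 n) p) p

/-- The form `α` read in the preferred chart at `p`, that is, its pullback by the inverse of the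
chart. It is meaningful on the (open) target of the chart. -/
def inChart {k : ℕ} (α : Form n k M) (p : M) (u : EuclideanSpace ℝ (Fin n)) :
    EuclideanSpace ℝ (Fin n) [⋀^Fin k]→L[ℝ] ℝ :=
  (α ((extChartAt (𝓡 n) p).symm u)).compContinuousLinearMap (chartInvDeriv p u)

/-- Smooth `k`-forms. -/
def IsSmooth {k : ℕ} (α : Form n k M) : Prop :=
  ∀ p : M, ContDiffOn ℝ ∞ (inChart α p) (extChartAt (𝓡 n) p).target

/-- The exterior derivative, computed at each point in the preferred chart there. -/
def extD {k : ℕ} (α : Form n k M) : Form n (k + 1) M := fun x =>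
  (extDeriv (inChart α x) (extChartAt (𝓡 n) x x)).compContinuousLinearMap (chartDeriv x)

/-- The standard basis of the model space, as a basis of the tangent space at `x` (which is the
model space as a vector space). -/
def stdVec (x : M) (i : Fin n) : TangentSpace (𝓡 n) x :=
  (EuclideanSpace.single i (1 : ℝ) : EuclideanSpace ℝ (Fin n))

variable [IsManifold (𝓡 n) ∞ M]

/-- Gram matrix `g_{ij}` of the metric at `x` in the basis `stdVec x`. -/
def gram (g : Metric n M) (x : M) : Matrix (Fin n) (Fin n) ℝ :=
  Matrix.of fun i j => g.inner x (stdVec x i) (stdVec x j)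

/-- The inner product on `Λᵏ T*ₓM` induced by the metric,
`⟨a, b⟩ = (1 / k!) ∑ g^{i₁j₁} ⋯ g^{iₖjₖ} a_{i₁…iₖ} b_{j₁…jₖ}`, where `(g^{ij})` is the inverse of
the Gram matrix. For an orthonormal coframe `(eⁱ)`, the forms `e^{i₁} ∧ ⋯ ∧ e^{iₖ}` with
`i₁ < ⋯ < iₖ` are orthonormal. -/
def formInner (g : Metric n M) {k : ℕ} (x : M) (a b : FormAt n k x) : ℝ :=
  ((k.factorial : ℝ))⁻¹ * ∑ I : Fin k → Fin n, ∑ J : Fin k → Fin n,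
    (∏ s : Fin k, (gram g x)⁻¹ (I s) (J s)) *
      a (fun s => stdVec x (I s)) * b (fun s => stdVec x (J s))

/-- The density `√det(g_{ij})` of the Riemannian volume in the preferred chart at `p`. -/
def volDensity (g : Metric n M) (p : M) (u : EuclideanSpace ℝ (Fin n)) : ℝ :=
  Real.sqrt (Matrix.det (Matrix.of fun i j : Fin n =>
    g.inner ((extChartAt (𝓡 n) p).symm u)
      (chartInvDeriv p u (EuclideanSpace.single i (1 : ℝ)))
      (chartInvDeriv p u (EuclideanSpace.single j (1 : ℝ)))))

/-- The Riemannian volume on the domain of the preferred chart at `p` (and zero outside it). -/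
def chartVolume [MeasurableSpace M] (g : Metric n M) (p : M) : MeasureTheory.Measure M :=
  ((MeasureTheory.volume.restrict (extChartAt (𝓡 n) p).target).withDensity
    (fun u => ENNReal.ofReal (volDensity g p u))).map (extChartAt (𝓡 n) p).symm

/-- A smooth partition of unity `(φ_p)` with the support of `φ_p` in the preferred chart at `p`. -/
def partition (n : ℕ) (M : Type*) [TopologicalSpace M]
    [ChartedSpace (EuclideanSpace ℝ (Fin n)) M] [IsManifold (𝓡 n) ∞ M]
    [CompactSpace M] [T2Space M] : SmoothPartitionOfUnity M (𝓡 n) M Set.univ :=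
  Classical.choose (SmoothPartitionOfUnity.exists_isSubordinate_chartAt_source (𝓡 n) M)

/-- The Riemannian volume measure `dμ_g = ∑_p φ_p √det(g_{ij}) du`, glued from the charts by a
partition of unity (the result does not depend on the partition). -/
def riemVolume [CompactSpace M] [T2Space M] [MeasurableSpace M] (g : Metric n M) :
    MeasureTheory.Measure M :=
  MeasureTheory.Measure.sum fun p : M =>
    (chartVolume g p).withDensity (fun x => ENNReal.ofReal (partition n M p x))

variable [CompactSpace M] [T2Space M] [MeasurableSpace M]

/-- The `L²` inner product of `k`-forms. -/
def l2Inner (g : Metric n M) {k : ℕ} (α β : Form n k M) : ℝ :=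
  ∫ x, formInner g x (α x) (β x) ∂(riemVolume g)

/-- `β = d* α`: the smooth form `β` is the value at `α` of the formal `L²` adjoint of `d`. -/
def IsCodifferential (g : Metric n M) {k : ℕ} (α : Form n (k + 1) M) (β : Form n k M) : Prop :=
  IsSmooth β ∧ ∀ γ : Form n k M, IsSmooth γ → l2Inner g β γ = l2Inner g α (extD γ)

/-- `η = Δ α` for the Hodge Laplacian `Δ = d d* + d* d` (which is `d* d` on functions). -/
def IsLaplacian (g : Metric n M) : {k : ℕ} → Form n k M → Form n k M → Prop
  | 0, α, η => IsCodifferential g (extD α) η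
  | _ + 1, α, η => ∃ β ζ, IsCodifferential g α β ∧ IsCodifferential g (extD α) ζ ∧
      η = extD β + ζ

/-- `α ∈ 𝓗ᵏ_g(M)`: the form `α` is smooth and `Δ α = 0`. -/
def IsHarmonic (g : Metric n M) {k : ℕ} (α : Form n k M) : Prop :=
  IsSmooth α ∧ IsLaplacian g α 0

/-- `η` is the `L²`-orthogonal projection of `θ` to the space of harmonic forms. -/
def IsHarmonicProjection (g : Metric n M) {k : ℕ} (θ η : Form n k M) : Prop :=
  IsHarmonic g η ∧ ∀ h : Form n k M, IsHarmonic g h → l2Inner g (θ - η) h = 0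

/-- `K` is the Schwartz kernel of the `L²`-orthogonal projection to the harmonic `k`-forms: a
continuous section `K(x, y) ∈ Hom(Λᵏ T*_yM, Λᵏ T*_xM)` over `M × M` (continuity is tested against
smooth forms) such that, for every smooth form `θ`, the form `x ↦ ∫ K(x, y) θ(y) dμ_g(y)` is the
projection of `θ`. The integral is the one of a function with values in the finite-dimensional
space `Λᵏ T*ₓM` and is evaluated on tangent vectors. -/
def IsHarmonicKernel (g : Metric n M) {k : ℕ}
    (K : (x y : M) → FormAt n k y →ₗ[ℝ] FormAt n k x) : Prop :=
  (∀ θ η : Form n k M, IsSmooth θ → IsSmooth η →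
    Continuous fun q : M × M => formInner g q.1 (K q.1 q.2 (θ q.2)) (η q.1)) ∧
  ∀ θ : Form n k M, IsSmooth θ → ∃ η : Form n k M, IsHarmonicProjection g θ η ∧
    ∀ (x : M) (v : Fin k → TangentSpace (𝓡 n) x),
      η x v = ∫ y, K x y (θ y) v ∂(riemVolume g)

/-- The values `|α(x)|²` for `α` harmonic with `‖α‖_{L²} = 1`. -/
def peakValues (g : Metric n M) (k : ℕ) (x : M) : Set ℝ :=
  {r | ∃ α : Form n k M, IsHarmonic g α ∧ l2Inner g α α = 1 ∧ r = formInner g x (α x) (α x)}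

end

end HarmonicKernel

open scoped Manifold ContDiff

/-
Idea. Fix `a ∈ ΛᵏT*ₓM`, extend it to a smooth form `θ`, let `f` be a smooth probability density
concentrating at `x`, and let `η` be the harmonic projection of `f θ`. As `f` tends to the point
mass at `x`, `‖η‖²` and `⟨η(x), a⟩` both tend to `⟨K(x, x) a, a⟩`, while `⟨η, α⟩_{L²}` tends to
`⟨a, α(x)⟩` for harmonic `α`. Hence `⟨K(x, x) a, a⟩ ≥ 0`, and the Cauchy–Schwarz inequality gives
`⟨a, α(x)⟩² ≤ ⟨K(x, x) a, a⟩ ‖α‖²`, which summed over an orthonormal basis yields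
`|α(x)|² ≤ Tr K(x, x) ‖α‖²`. Writing `S` for the supremum, `|η(x)|² ≤ S ‖η‖²` becomes
`⟨K(x, x) a, a⟩² ≤ S |a|² ⟨K(x, x) a, a⟩` in the limit, so `⟨K(x, x) a, a⟩ ≤ S |a|²`; summing
over an orthonormal basis of the fibre, which has at most `n.choose k` elements, bounds the trace.
-/

namespace HarmonicKernel

open scoped Topology Matrix
open Filter MeasureTheory

noncomputable section

section KroneckerPower

variable {σ ι κ τ R 𝕜 : Type*} [Fintype σ]

/-- The Kronecker power of a matrix with `σ` factors: the matrix of the tensor power of a linear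
map, with rows and columns indexed by multi-indices. -/
def kroneckerPow (σ : Type*) [Fintype σ] [CommMonoid R] (A : Matrix ι κ R) :
    Matrix (σ → ι) (σ → κ) R :=
  Matrix.of fun I J => ∏ s, A (I s) (J s)

theorem kroneckerPow_apply [CommMonoid R] (A : Matrix ι κ R) (I : σ → ι) (J : σ → κ) :
    kroneckerPow σ A I J = ∏ s, A (I s) (J s) := rfl

theorem kroneckerPow_transpose [CommMonoid R] (A : Matrix ι κ R) :
    kroneckerPow σ Aᵀ = (kroneckerPow σ A)ᵀ := rfl

theorem kroneckerPow_mul [DecidableEq σ] [Fintype κ] [CommSemiring R] (A : Matrix ι κ R)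
    (B : Matrix κ τ R) : kroneckerPow σ (A * B) = kroneckerPow σ A * kroneckerPow σ B := by
  ext I J
  simp only [kroneckerPow_apply, Matrix.mul_apply, Finset.prod_univ_sum, Fintype.piFinset_univ,
    Finset.prod_mul_distrib]

theorem kroneckerPow_one [DecidableEq ι] [DecidableEq (σ → ι)] [CommSemiring R] :
    kroneckerPow σ (1 : Matrix ι ι R) = 1 := by
  ext I J
  simp only [kroneckerPow_apply, Matrix.one_apply, Finset.prod_ite_zero, Finset.prod_const_one,
    Finset.mem_univ, true_implies, funext_iff]

theorem kroneckerPow_conjTranspose [CommSemiring R] [StarRing R] (A : Matrix ι κ R) :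
    kroneckerPow σ Aᴴ = (kroneckerPow σ A)ᴴ := by
  ext I J
  simp only [kroneckerPow_apply, Matrix.conjTranspose_apply, star_prod]

theorem continuous_kroneckerPow [CommMonoid R] [TopologicalSpace R] [ContinuousMul R] :
    Continuous (kroneckerPow σ : Matrix ι κ R → Matrix (σ → ι) (σ → κ) R) :=
  continuous_pi fun _ => continuous_pi fun _ =>
    continuous_finsetProd _ fun _ _ => continuous_id.matrix_elem _ _

open scoped MatrixOrder ComplexOrder in
theorem posDef_kroneckerPow [Finite ι] [RCLike 𝕜] {G : Matrix ι ι 𝕜} (hG : G.PosDef) :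
    (kroneckerPow σ G).PosDef := by
  classical
  have := Fintype.ofFinite ι
  obtain ⟨y, hy, rfl⟩ := CStarAlgebra.isStrictlyPositive_iff_eq_star_mul_self.mp
    hG.isStrictlyPositive
  have h_inv : kroneckerPow σ y⁻¹ * kroneckerPow σ y = 1 := by
    rw [← kroneckerPow_mul, Matrix.nonsing_inv_mul _ ((Matrix.isUnit_iff_isUnit_det y).1 hy),
      kroneckerPow_one]
  rw [kroneckerPow_mul, Matrix.star_eq_conjTranspose, kroneckerPow_conjTranspose]
  refine Matrix.PosDef.conjTranspose_mul_self _ ?_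
  exact Matrix.mulVec_injective_of_isUnit (IsUnit.of_mul_eq_one_right _ h_inv)

end KroneckerPower

section AlternatingForms

variable {σ ι E : Type*} [AddCommGroup E] [Module ℝ E] [TopologicalSpace E]

/-- The components `a (v_{I s})_s` of an alternating form `a` in a family of vectors `v`, indexed by
all (not only increasing) multi-indices `I`. -/
def components (σ : Type*) (v : ι → E) : (E [⋀^σ]→L[ℝ] ℝ) →ₗ[ℝ] ((σ → ι) → ℝ) where
  toFun a I := a (v ∘ I)
  map_add' _ _ := rfl
  map_smul' _ _ := rfl

theorem components_apply (v : ι → E) (a : E [⋀^σ]→L[ℝ] ℝ) (I : σ → ι) :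
    components σ v a I = a (v ∘ I) := rfl

theorem continuous_components [ContinuousSMul ℝ E] (v : ι → E) : Continuous (components σ v) :=
  continuous_pi fun _ => continuous_eval_const _

theorem components_injective [Finite σ] (b : Module.Basis ι ℝ E) :
    Function.Injective (components σ b) := fun _ _ h =>
  ContinuousAlternatingMap.toAlternatingMap_injective <|
    b.ext_alternating fun I _ => congrFun h I

theorem components_eq_vecMul [Fintype σ] [DecidableEq σ] [Fintype ι] {κ : Type*}
    (b : Module.Basis ι ℝ E) (v : κ → E) (a : E [⋀^σ]→L[ℝ] ℝ) :
    components σ v a = components σ b a ᵥ* kroneckerPow σ (b.toMatrix v) := by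
  ext J
  have h_expand : v ∘ J = fun s => ∑ i, b.toMatrix v i (J s) • b i :=
    funext fun s => (b.sum_toMatrix_smul_self v (J s)).symm
  rw [components_apply, h_expand]
  refine (a.toMultilinearMap.map_sum _).trans (Finset.sum_congr rfl fun I _ => ?_)
  exact (a.toMultilinearMap.map_smul_univ _ _).trans (mul_comm _ _)

theorem exists_dual_eq_sum_components [Finite σ] [Fintype (σ → ι)] (b : Module.Basis ι ℝ E)
    (ℓ : Module.Dual ℝ (E [⋀^σ]→L[ℝ] ℝ)) :
    ∃ c : (σ → ι) → ℝ, ∀ a, ℓ a = ∑ I, components σ b a I * c I := by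
  classical
  obtain ⟨r, hr⟩ := (components σ b).exists_leftInverse_of_injective
    (LinearMap.ker_eq_bot.2 (components_injective b))
  refine ⟨fun I => ℓ (r fun J => if I = J then 1 else 0), fun a => ?_⟩
  have h_factor : ℓ a = (ℓ ∘ₗ r) (components σ b a) :=
    congrArg ℓ (LinearMap.congr_fun hr a).symm
  rw [h_factor, LinearMap.pi_apply_eq_sum_univ]
  rfl

theorem finiteDimensional_alternating [Finite σ] [FiniteDimensional ℝ E] :
    FiniteDimensional ℝ (E [⋀^σ]→L[ℝ] ℝ) :=
  FiniteDimensional.of_injective _ (components_injective (Module.finBasis ℝ E))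

theorem finrank_alternating_le {k : ℕ} [FiniteDimensional ℝ E] :
    Module.finrank ℝ (E [⋀^Fin k]→L[ℝ] ℝ) ≤ (Module.finrank ℝ E).choose k := by
  rw [← exteriorPower.finrank_eq (R := ℝ), ← Subspace.dual_finrank_eq (V := ⋀[ℝ]^k E)]
  exact LinearMap.finrank_le_finrank_of_injective
    (f := exteriorPower.alternatingMapLinearEquiv.toLinearMap ∘ₗ
      ContinuousAlternatingMap.toAlternatingMapLinear)
    (exteriorPower.alternatingMapLinearEquiv.injective.comp
      ContinuousAlternatingMap.toAlternatingMap_injective)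

section Induced

variable [Fintype σ] [DecidableEq σ] [Fintype ι] [DecidableEq ι]

/-- The bilinear form `∑ (∏ₛ g^{Iₛ Jₛ}) a_I a'_J` induced by `B` on alternating forms, where
`g^{ij}` is the inverse of the Gram matrix of `B` in the basis `b` and both sums run over all
multi-indices, so that every increasing multi-index contributes `(card σ)!` times. -/
def inducedBilin (σ : Type*) [Fintype σ] [DecidableEq σ] (B : LinearMap.BilinForm ℝ E)
    (b : Module.Basis ι ℝ E) : LinearMap.BilinForm ℝ (E [⋀^σ]→L[ℝ] ℝ) :=
  (Matrix.toBilin' (kroneckerPow σ (LinearMap.BilinForm.toMatrix b B)⁻¹)).comp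
    (components σ b) (components σ b)

theorem inducedBilin_apply (B : LinearMap.BilinForm ℝ E) (b : Module.Basis ι ℝ E)
    (a a' : E [⋀^σ]→L[ℝ] ℝ) :
    inducedBilin σ B b a a' = components σ b a ⬝ᵥ
      kroneckerPow σ (LinearMap.BilinForm.toMatrix b B)⁻¹ *ᵥ components σ b a' :=
  Matrix.toBilin'_apply' _ _ _

theorem inducedBilin_eq_inducedBilin (B : LinearMap.BilinForm ℝ E) (b c : Module.Basis ι ℝ E) :
    inducedBilin σ B b = inducedBilin σ B c := by
  ext a a'
  set A := b.toMatrix c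
  set G := LinearMap.BilinForm.toMatrix b B
  have hA : IsUnit A.det := (Matrix.isUnit_iff_isUnit_det _).1
    (IsUnit.of_mul_eq_one _ (b.toMatrix_mul_toMatrix_flip c))
  have hAt : IsUnit Aᵀ.det := by rwa [Matrix.det_transpose]
  have h_gram : LinearMap.BilinForm.toMatrix c B = Aᵀ * G * A :=
    (LinearMap.BilinForm.toMatrix_mul_basis_toMatrix b c B).symm
  have h_inv : A * (Aᵀ * G * A)⁻¹ * Aᵀ = G⁻¹ := by
    rw [Matrix.mul_inv_rev, Matrix.mul_inv_rev, Matrix.mul_nonsing_inv_cancel_left _ _ hA,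
      Matrix.mul_assoc, Matrix.nonsing_inv_mul _ hAt, Matrix.mul_one]
  rw [inducedBilin_apply, inducedBilin_apply, components_eq_vecMul b c, components_eq_vecMul b c,
    h_gram, ← h_inv, kroneckerPow_mul, kroneckerPow_mul, kroneckerPow_transpose,
    ← Matrix.mulVec_transpose _ (components σ b a'), ← Matrix.dotProduct_mulVec,
    Matrix.mulVec_mulVec, Matrix.mulVec_mulVec, Matrix.mul_assoc]

theorem inducedBilin_isSymm {B : LinearMap.BilinForm ℝ E} {b : Module.Basis ι ℝ E}
    (hB : B.IsSymm) : (inducedBilin σ B b).IsSymm := by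
  have h_gram : (LinearMap.BilinForm.toMatrix b B)ᵀ = LinearMap.BilinForm.toMatrix b B := by
    ext i j
    simp only [Matrix.transpose_apply, LinearMap.BilinForm.toMatrix_apply, hB.eq (b i) (b j)]
  refine ⟨fun a a' => ?_⟩
  rw [inducedBilin_apply, inducedBilin_apply, Matrix.dotProduct_mulVec,
    dotProduct_comm, ← Matrix.mulVec_transpose, ← kroneckerPow_transpose,
    Matrix.transpose_nonsing_inv, h_gram]

theorem inducedBilin_self_pos {B : LinearMap.BilinForm ℝ E} {b : Module.Basis ι ℝ E}
    (hB : (LinearMap.BilinForm.toMatrix b B).PosDef) {a : E [⋀^σ]→L[ℝ] ℝ} (ha : a ≠ 0) :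
    0 < inducedBilin σ B b a a := by
  rw [inducedBilin_apply]
  exact (posDef_kroneckerPow (𝕜 := ℝ) hB.inv).dotProduct_mulVec_pos
    ((map_ne_zero_iff _ (components_injective b)).2 ha)

end Induced

end AlternatingForms

section OrthonormalBasis

variable {V : Type*} [AddCommGroup V] [Module ℝ V] {B : LinearMap.BilinForm ℝ V}

theorem exists_orthonormal_basis [FiniteDimensional ℝ V] (hB : B.IsSymm)
    (hpos : ∀ a, a ≠ 0 → 0 < B a a) :
    ∃ b : Module.Basis (Fin (Module.finrank ℝ V)) ℝ V,
      ∀ i j, B (b i) (b j) = if i = j then 1 else 0 := by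
  let core : InnerProductSpace.Core ℝ V :=
    { inner a a' := B a a'
      conj_inner_symm a a' := hB.eq a' a
      re_inner_nonneg a := by
        rcases eq_or_ne a 0 with rfl | ha
        · simp
        · exact (hpos a ha).le
      add_left a a' c := by simp
      smul_left a c r := by simp
      definite a := by
        contrapose!
        exact fun ha => (hpos a ha).ne' }
  let _ : NormedAddCommGroup V := core.toNormedAddCommGroup
  let _ : InnerProductSpace ℝ V := .ofCore core.toCore
  refine ⟨(stdOrthonormalBasis ℝ V).toBasis, fun i j => ?_⟩
  rw [OrthonormalBasis.coe_toBasis]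
  exact orthonormal_iff_ite.1 (stdOrthonormalBasis ℝ V).orthonormal i j

variable {ι : Type*} [DecidableEq ι] {b : Module.Basis ι ℝ V}

theorem repr_eq_of_orthonormal [Finite ι]
    (hb : ∀ i j, B (b i) (b j) = if i = j then 1 else 0) (a : V) (i : ι) :
    b.repr a i = B a (b i) := by
  have := Fintype.ofFinite ι
  conv_rhs => rw [← b.sum_repr a]
  simp only [map_sum, map_smul, LinearMap.sum_apply, LinearMap.smul_apply, hb, smul_eq_mul,
    mul_ite, mul_one, mul_zero, Finset.sum_ite_eq', Finset.mem_univ, if_true]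

variable [Fintype ι]

theorem trace_eq_sum_of_orthonormal (hb : ∀ i j, B (b i) (b j) = if i = j then 1 else 0)
    (T : V →ₗ[ℝ] V) : LinearMap.trace ℝ V T = ∑ i, B (T (b i)) (b i) := by
  simp only [LinearMap.trace_eq_matrix_trace ℝ b, Matrix.trace, Matrix.diag_apply,
    LinearMap.toMatrix_apply, repr_eq_of_orthonormal hb]

theorem dual_eq_of_orthonormal (hb : ∀ i j, B (b i) (b j) = if i = j then 1 else 0)
    (ℓ : Module.Dual ℝ V) (a : V) : ℓ a = B a (∑ i, ℓ (b i) • b i) := by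
  conv_lhs => rw [← b.sum_repr a]
  simp only [map_sum, map_smul, smul_eq_mul, repr_eq_of_orthonormal hb, mul_comm]

theorem self_eq_sum_sq_of_orthonormal (hb : ∀ i j, B (b i) (b j) = if i = j then 1 else 0)
    (a : V) : B a a = ∑ i, B a (b i) ^ 2 := by
  rw [dual_eq_of_orthonormal hb (B a) a]
  simp only [map_sum, map_smul, smul_eq_mul, sq]

end OrthonormalBasis

section FormInner

variable {n k : ℕ} {M : Type*} [TopologicalSpace M] [ChartedSpace (EuclideanSpace ℝ (Fin n)) M]

/-- The family `stdVec x`, as a basis of the tangent space. -/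
def stdBasis (x : M) : Module.Basis (Fin n) ℝ (TangentSpace (𝓡 n) x) :=
  (EuclideanSpace.basisFun (Fin n) ℝ).toBasis

theorem stdBasis_apply (x : M) (i : Fin n) : stdBasis x i = stdVec x i :=
  (congrFun (EuclideanSpace.basisFun (Fin n) ℝ).coe_toBasis i).trans
    (EuclideanSpace.basisFun_apply ..)

instance finiteDimensional_formAt (x : M) : FiniteDimensional ℝ (FormAt n k x) :=
  have := (stdBasis (n := n) x).finiteDimensional_of_finite
  finiteDimensional_alternating

theorem finrank_formAt_le (x : M) : Module.finrank ℝ (FormAt n k x) ≤ n.choose k := by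
  have := (stdBasis (n := n) x).finiteDimensional_of_finite
  refine finrank_alternating_le.trans_eq ?_
  rw [Module.finrank_eq_card_basis (stdBasis (n := n) x), Fintype.card_fin]

variable [IsManifold (𝓡 n) ∞ M] (g : Metric n M) (x : M)

/-- The metric at `x`, as a bilinear form on the tangent space. -/
def metricBilin : LinearMap.BilinForm ℝ (TangentSpace (𝓡 n) x) :=
  (g.inner x).toLinearMap₁₂

theorem metricBilin_isSymm : (metricBilin g x).IsSymm := ⟨fun v w => g.symm x v w⟩

theorem posDef_toMatrix_metricBilin {ι : Type*} [Fintype ι] [DecidableEq ι]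
    (b : Module.Basis ι ℝ (TangentSpace (𝓡 n) x)) :
    (LinearMap.BilinForm.toMatrix b (metricBilin g x)).PosDef :=
  (LinearMap.BilinForm.posDef_toQuadraticMap_iff_matrix b _ (metricBilin_isSymm g x)).1
    fun v hv => g.pos x v hv

/-- The inner product of forms at `x`, as a bilinear form on the fibre. -/
def formBilin : LinearMap.BilinForm ℝ (FormAt n k x) :=
  (k.factorial : ℝ)⁻¹ • inducedBilin (Fin k) (metricBilin g x) (stdBasis x)

theorem formInner_eq_formBilin (a b : FormAt n k x) :
    formInner g x a b = formBilin g x a b := by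
  have h_gram : LinearMap.BilinForm.toMatrix (stdBasis x) (metricBilin g x) = gram g x := by
    ext i j
    rw [LinearMap.BilinForm.toMatrix_apply, stdBasis_apply, stdBasis_apply]
    rfl
  rw [formBilin, LinearMap.smul_apply, LinearMap.smul_apply, inducedBilin_apply, h_gram, formInner]
  simp only [dotProduct, Matrix.mulVec, components_apply, kroneckerPow_apply, Finset.mul_sum,
    Function.comp_def, stdBasis_apply, smul_eq_mul]
  congr! 3
  ring

theorem formBilin_isSymm : (formBilin (k := k) g x).IsSymm :=
  (inducedBilin_isSymm (metricBilin_isSymm g x)).smul _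

theorem formBilin_self_pos {a : FormAt n k x} (ha : a ≠ 0) : 0 < formBilin g x a a :=
  mul_pos (by positivity) (inducedBilin_self_pos (posDef_toMatrix_metricBilin g x _) ha)

theorem formBilin_self_nonneg (a : FormAt n k x) : 0 ≤ formBilin g x a a := by
  rcases eq_or_ne a 0 with rfl | ha
  · rw [map_zero]
  · exact (formBilin_self_pos g x ha).le

theorem formBilin_sq_le (a b : FormAt n k x) :
    formBilin g x a b ^ 2 ≤ formBilin g x a a * formBilin g x b b :=
  LinearMap.BilinForm.apply_sq_le_of_symm _ (formBilin_self_nonneg g x)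
    ⟨(formBilin_isSymm g x).eq⟩ a b

end FormInner

section ContinuousInCharts

theorem continuous_of_continuousOn_extChartAt_symm {𝕜 E H M Y : Type*} [NontriviallyNormedField 𝕜]
    [NormedAddCommGroup E] [NormedSpace 𝕜 E] [TopologicalSpace H] (I : ModelWithCorners 𝕜 E H)
    [TopologicalSpace M] [ChartedSpace H M] [TopologicalSpace Y] {f : M → Y}
    (hf : ∀ p : M, ContinuousOn (f ∘ (extChartAt I p).symm) (extChartAt I p).target) :
    Continuous f := by
  refine continuous_iff_continuousAt.2 fun p => ?_
  refine (((hf p).comp (continuousOn_extChartAt p) (extChartAt I p).mapsTo).congr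
    fun y hy => ?_).continuousAt (extChartAt_source_mem_nhds p)
  exact congrArg f ((extChartAt I p).left_inv hy).symm

end ContinuousInCharts

section ChartFrame

variable {n k : ℕ} {M : Type*} [TopologicalSpace M] [ChartedSpace (EuclideanSpace ℝ (Fin n)) M]
  [IsManifold (𝓡 n) ∞ M]

theorem chartInvDeriv_isInvertible (p : M) {u : EuclideanSpace ℝ (Fin n)}
    (hu : u ∈ (extChartAt (𝓡 n) p).target) : (chartInvDeriv p u).IsInvertible := by
  have h := isInvertible_mfderivWithin_extChartAt_symm hu
  rwa [modelWithCornersSelf_coe, Set.range_id, mfderivWithin_univ] at h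

theorem exists_basis_eq_chartInvDeriv (p : M) {u : EuclideanSpace ℝ (Fin n)}
    (hu : u ∈ (extChartAt (𝓡 n) p).target) :
    ∃ b : Module.Basis (Fin n) ℝ (TangentSpace (𝓡 n) ((extChartAt (𝓡 n) p).symm u)),
      ∀ i, b i = chartInvDeriv p u (EuclideanSpace.single i 1) := by
  obtain ⟨e, he⟩ := chartInvDeriv_isInvertible p hu
  refine ⟨(EuclideanSpace.basisFun (Fin n) ℝ).toBasis.map e.toLinearEquiv, fun i => ?_⟩
  rw [Module.Basis.map_apply, OrthonormalBasis.coe_toBasis, EuclideanSpace.basisFun_apply, ← he]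
  rfl

/-- Gram matrix of the metric in the coordinate frame of the preferred chart at `p`. -/
def chartGram (g : Metric n M) (p : M) (u : EuclideanSpace ℝ (Fin n)) :
    Matrix (Fin n) (Fin n) ℝ :=
  Matrix.of fun i j => g.inner ((extChartAt (𝓡 n) p).symm u)
    (chartInvDeriv p u (EuclideanSpace.single i 1)) (chartInvDeriv p u (EuclideanSpace.single j 1))

theorem toMatrix_metricBilin_eq_chartGram (g : Metric n M) {p : M} {u : EuclideanSpace ℝ (Fin n)}
    {b : Module.Basis (Fin n) ℝ (TangentSpace (𝓡 n) ((extChartAt (𝓡 n) p).symm u))}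
    (hb : ∀ i, b i = chartInvDeriv p u (EuclideanSpace.single i 1)) :
    LinearMap.BilinForm.toMatrix b (metricBilin g _) = chartGram g p u := by
  ext i j
  rw [LinearMap.BilinForm.toMatrix_apply, hb, hb]
  rfl

theorem posDef_chartGram (g : Metric n M) (p : M) {u : EuclideanSpace ℝ (Fin n)}
    (hu : u ∈ (extChartAt (𝓡 n) p).target) : (chartGram g p u).PosDef := by
  obtain ⟨b, hb⟩ := exists_basis_eq_chartInvDeriv p hu
  rw [← toMatrix_metricBilin_eq_chartGram g hb]
  exact posDef_toMatrix_metricBilin g _ b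

theorem formBilin_eq_inChart (g : Metric n M) {p : M} {u : EuclideanSpace ℝ (Fin n)}
    (hu : u ∈ (extChartAt (𝓡 n) p).target) (α β : Form n k M) :
    formBilin g ((extChartAt (𝓡 n) p).symm u) (α _) (β _) = (k.factorial : ℝ)⁻¹ *
      (components (Fin k) (fun i => EuclideanSpace.single i 1) (inChart α p u) ⬝ᵥ
        kroneckerPow (Fin k) (chartGram g p u)⁻¹ *ᵥ
          components (Fin k) (fun i => EuclideanSpace.single i 1) (inChart β p u)) := by
  obtain ⟨b, hb⟩ := exists_basis_eq_chartInvDeriv p hu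
  have h_comp : ∀ γ : Form n k M, components (Fin k) b (γ _) =
      components (Fin k) (fun i => EuclideanSpace.single i 1) (inChart γ p u) := fun γ => by
    rw [funext hb]
    rfl
  rw [formBilin, inducedBilin_eq_inducedBilin _ _ b, LinearMap.smul_apply, LinearMap.smul_apply,
    inducedBilin_apply, toMatrix_metricBilin_eq_chartGram g hb, h_comp, h_comp, smul_eq_mul]

theorem continuousOn_chartInvDeriv (p : M) (e : EuclideanSpace ℝ (Fin n)) :
    ContinuousOn (fun u => (⟨(extChartAt (𝓡 n) p).symm u, chartInvDeriv p u e⟩ :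
      TangentBundle (𝓡 n) M)) (extChartAt (𝓡 n) p).target := by
  have h_tangentMap := (contMDiffOn_extChartAt_symm (I := 𝓡 n) (n := 1) p)
    |>.continuousOn_tangentMapWithin le_rfl (isOpen_extChartAt_target p).uniqueMDiffOn
  have h_const : Continuous fun u : EuclideanSpace ℝ (Fin n) =>
      (⟨u, e⟩ : TangentBundle 𝓘(ℝ, EuclideanSpace ℝ (Fin n)) (EuclideanSpace ℝ (Fin n))) :=
    (tangentBundleModelSpaceHomeomorph _).symm.continuous.comp
      (continuous_id.prodMk continuous_const)
  refine (h_tangentMap.comp h_const.continuousOn fun u hu => hu).congr fun u hu => ?_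
  simp only [tangentMapWithin, Function.comp, chartInvDeriv]
  rw [mfderivWithin_of_isOpen (isOpen_extChartAt_target p) hu]
  rfl

theorem continuousOn_chartGram (g : Metric n M) (p : M) :
    ContinuousOn (chartGram g p) (extChartAt (𝓡 n) p).target := by
  refine continuousOn_pi.2 fun i => continuousOn_pi.2 fun j => fun u hu => ?_
  have h_frame := fun l : Fin n =>
    continuousOn_chartInvDeriv (M := M) p (EuclideanSpace.single l 1) u hu
  have h_metric : ContinuousWithinAt (fun u => (⟨(extChartAt (𝓡 n) p).symm u,
      g.inner ((extChartAt (𝓡 n) p).symm u)⟩ : Bundle.TotalSpace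
        (EuclideanSpace ℝ (Fin n) →L[ℝ] EuclideanSpace ℝ (Fin n) →L[ℝ] ℝ)
        (fun x : M => TangentSpace (𝓡 n) x →L[ℝ] TangentSpace (𝓡 n) x →L[ℝ] ℝ)))
      (extChartAt (𝓡 n) p).target u :=
    g.contMDiff.continuous.continuousAt.comp_continuousWithinAt
      (f := (extChartAt (𝓡 n) p).symm) (continuousOn_extChartAt_symm p u hu)
  have h_apply := h_metric.clm_bundle_apply₂ (F₁ := EuclideanSpace ℝ (Fin n))
    (F₂ := EuclideanSpace ℝ (Fin n)) (F₃ := ℝ) (E₃ := Bundle.Trivial M ℝ) (h_frame i) (h_frame j)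
  rw [FiberBundle.continuousWithinAt_totalSpace] at h_apply
  exact h_apply.2

theorem continuousOn_chartGram_inv (g : Metric n M) (p : M) :
    ContinuousOn (fun u => (chartGram g p u)⁻¹) (extChartAt (𝓡 n) p).target := fun u hu =>
  have h_inverse : ContinuousAt Ring.inverse (chartGram g p u).det := by
    rw [Ring.inverse_eq_inv']
    exact continuousAt_inv₀ (posDef_chartGram g p hu).det_pos.ne'
  (continuousAt_matrix_inv _ h_inverse).comp_continuousWithinAt (continuousOn_chartGram g p u hu)

theorem continuous_formBilin (g : Metric n M) {α β : Form n k M} (hα : IsSmooth α)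
    (hβ : IsSmooth β) : Continuous fun x => formBilin g x (α x) (β x) := by
  refine continuous_of_continuousOn_extChartAt_symm (𝓡 n) fun p => ?_
  have h_components : ∀ {γ : Form n k M}, IsSmooth γ → ContinuousOn (fun u => components (Fin k)
      (fun i => EuclideanSpace.single i 1) (inChart γ p u)) (extChartAt (𝓡 n) p).target :=
    fun hγ => (continuous_components _).comp_continuousOn (hγ p).continuousOn
  have h_pow := (continuous_kroneckerPow (σ := Fin k)).comp_continuousOn
    (continuousOn_chartGram_inv g p)
  have h_contract : Continuous fun q : ((Fin k → Fin n) → ℝ) ×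
      Matrix (Fin k → Fin n) (Fin k → Fin n) ℝ × ((Fin k → Fin n) → ℝ) =>
        (k.factorial : ℝ)⁻¹ * (q.1 ⬝ᵥ q.2.1 *ᵥ q.2.2) :=
    continuous_const.mul
      (continuous_fst.dotProduct (continuous_snd.fst.matrix_mulVec continuous_snd.snd))
  exact (h_contract.comp_continuousOn
    ((h_components hα).prodMk (h_pow.prodMk (h_components hβ)))).congr
      fun u hu => formBilin_eq_inChart g hu α β

end ChartFrame

section SmoothForms

section ModelSpace

variable {σ X E F : Type*} [Fintype σ] [NormedAddCommGroup X] [NormedSpace ℝ X]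
  [NormedAddCommGroup E] [NormedSpace ℝ E] [FiniteDimensional ℝ E] [NormedAddCommGroup F]
  [NormedSpace ℝ F] {m : WithTop ℕ∞} {u : X}

theorem contDiffAt_alternating_of_eval {c : X → E [⋀^σ]→L[ℝ] ℝ}
    (hc : ∀ v, ContDiffAt ℝ m (fun t => c t v) u) : ContDiffAt ℝ m c u := by
  classical
  have : FiniteDimensional ℝ (E [⋀^σ]→L[ℝ] ℝ) := finiteDimensional_alternating
  obtain ⟨r, hr⟩ := (components σ (Module.finBasis ℝ E)).exists_leftInverse_of_injective
    (LinearMap.ker_eq_bot.2 (components_injective _))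
  have h_eq : c = fun t => r.toContinuousLinearMap (components σ (Module.finBasis ℝ E) (c t)) :=
    funext fun t => (LinearMap.congr_fun hr (c t)).symm
  rw [h_eq]
  exact r.toContinuousLinearMap.contDiff.contDiffAt.comp u (contDiffAt_pi.2 fun I => hc _)

theorem contDiffAt_compContinuousLinearMap (a : F [⋀^σ]→L[ℝ] ℝ) {L : X → E →L[ℝ] F}
    (hL : ContDiffAt ℝ m L u) : ContDiffAt ℝ m (fun t => a.compContinuousLinearMap (L t)) u :=
  contDiffAt_alternating_of_eval fun v =>
    a.toContinuousMultilinearMap.contDiff.contDiffAt.comp u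
      (contDiffAt_pi.2 fun s => hL.clm_apply (contDiffAt_const (c := v s)))

end ModelSpace

variable {n k : ℕ} {M : Type*} [TopologicalSpace M] [ChartedSpace (EuclideanSpace ℝ (Fin n)) M]
  {α β : Form n k M}

theorem IsSmooth.add (hα : IsSmooth α) (hβ : IsSmooth β) : IsSmooth (α + β) :=
  fun p => (hα p).add (hβ p)

theorem IsSmooth.const_smul (hα : IsSmooth α) (c : ℝ) : IsSmooth (c • α) :=
  fun p => (hα p).const_smul c

variable [IsManifold (𝓡 n) ∞ M]

theorem contDiffOn_comp_extChartAt_symm {f : M → ℝ} (hf : ContMDiff (𝓡 n) 𝓘(ℝ) ∞ f) (p : M) :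
    ContDiffOn ℝ ∞ (f ∘ (extChartAt (𝓡 n) p).symm) (extChartAt (𝓡 n) p).target :=
  (hf.comp_contMDiffOn (contMDiffOn_extChartAt_symm p)).contDiffOn

theorem IsSmooth.fun_smul (hα : IsSmooth α) {f : M → ℝ} (hf : ContMDiff (𝓡 n) 𝓘(ℝ) ∞ f) :
    IsSmooth fun x => f x • α x :=
  fun p => (contDiffOn_comp_extChartAt_symm hf p).smul (hα p)

theorem contDiffAt_fderiv_chart_transition {x p : M} {u : EuclideanSpace ℝ (Fin n)}
    (hu : u ∈ (extChartAt (𝓡 n) p).target)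
    (hx : (extChartAt (𝓡 n) p).symm u ∈ (extChartAt (𝓡 n) x).source) :
    ContDiffAt ℝ ∞ (fderiv ℝ (extChartAt (𝓡 n) x ∘ (extChartAt (𝓡 n) p).symm)) u :=
  have h_transition : ContMDiffAt 𝓘(ℝ, EuclideanSpace ℝ (Fin n)) 𝓘(ℝ, EuclideanSpace ℝ (Fin n)) ∞
      (extChartAt (𝓡 n) x ∘ (extChartAt (𝓡 n) p).symm) u :=
    (contMDiffAt_extChartAt' (by rwa [extChartAt_source] at hx)).comp u
      ((contMDiffOn_extChartAt_symm p).contMDiffAt ((isOpen_extChartAt_target p).mem_nhds hu))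
  h_transition.contDiffAt.fderiv_right (by simp)

theorem fderiv_chart_transition {x p : M} {u : EuclideanSpace ℝ (Fin n)}
    (hu : u ∈ (extChartAt (𝓡 n) p).target)
    (hx : (extChartAt (𝓡 n) p).symm u ∈ (extChartAt (𝓡 n) x).source) :
    fderiv ℝ (extChartAt (𝓡 n) x ∘ (extChartAt (𝓡 n) p).symm) u =
      (mfderiv (𝓡 n) 𝓘(ℝ, EuclideanSpace ℝ (Fin n)) (extChartAt (𝓡 n) x)
        ((extChartAt (𝓡 n) p).symm u)).comp (chartInvDeriv p u) := by
  rw [← mfderiv_eq_fderiv]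
  refine mfderiv_comp u (mdifferentiableAt_extChartAt (by rwa [extChartAt_source] at hx)) ?_
  exact ((contMDiffOn_extChartAt_symm (n := 1) p).contMDiffAt
    ((isOpen_extChartAt_target p).mem_nhds hu)).mdifferentiableAt one_ne_zero

/-- The pullback by the preferred chart at `x` of a form on the model space with constant
coefficients. It is meaningful on the source of the chart. -/
def chartPullback (x : M) (a : EuclideanSpace ℝ (Fin n) [⋀^Fin k]→L[ℝ] ℝ) : Form n k M :=
  fun y => a.compContinuousLinearMap
    (mfderiv (𝓡 n) 𝓘(ℝ, EuclideanSpace ℝ (Fin n)) (extChartAt (𝓡 n) x) y)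

theorem contDiffAt_inChart_chartPullback {x p : M} {u : EuclideanSpace ℝ (Fin n)}
    (hu : u ∈ (extChartAt (𝓡 n) p).target)
    (hx : (extChartAt (𝓡 n) p).symm u ∈ (extChartAt (𝓡 n) x).source)
    (a : EuclideanSpace ℝ (Fin n) [⋀^Fin k]→L[ℝ] ℝ) :
    ContDiffAt ℝ ∞ (inChart (chartPullback x a) p) u := by
  refine (contDiffAt_compContinuousLinearMap a
    (contDiffAt_fderiv_chart_transition hu hx)).congr_of_eventuallyEq ?_
  filter_upwards [(isOpen_extChartAt_target p).mem_nhds hu,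
    (continuousAt_extChartAt_symm'' hu).eventually_mem
      ((isOpen_extChartAt_source x).mem_nhds hx)] with t ht htx
  rw [fderiv_chart_transition ht htx]
  rfl

theorem isSmooth_bump_smul [T2Space M] {x : M} (ρ : SmoothBumpFunction (𝓡 n) x)
    (hα : ∀ p, ∀ u ∈ (extChartAt (𝓡 n) p).target,
      (extChartAt (𝓡 n) p).symm u ∈ (extChartAt (𝓡 n) x).source →
        ContDiffAt ℝ ∞ (inChart α p) u) :
    IsSmooth fun y => ρ y • α y := by
  refine fun p u hu => ContDiffAt.contDiffWithinAt ?_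
  by_cases hs : (extChartAt (𝓡 n) p).symm u ∈ tsupport ρ
  · have hx : (extChartAt (𝓡 n) p).symm u ∈ (extChartAt (𝓡 n) x).source := by
      rw [extChartAt_source]
      exact ρ.tsupport_subset_chartAt_source hs
    exact ((contDiffOn_comp_extChartAt_symm ρ.contMDiff p).contDiffAt
      ((isOpen_extChartAt_target p).mem_nhds hu)).smul (hα p u hu hx)
  · refine (contDiffAt_const (c := 0)).congr_of_eventuallyEq ?_
    filter_upwards [(continuousAt_extChartAt_symm'' hu).eventually_mem
      ((isClosed_tsupport ρ).isOpen_compl.mem_nhds hs)] with t ht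
    ext v
    change ρ _ * _ = 0
    rw [image_eq_zero_of_notMem_tsupport ht, zero_mul]

theorem exists_isSmooth_apply_eq [T2Space M] (x : M) (a : FormAt n k x) :
    ∃ θ : Form n k M, IsSmooth θ ∧ θ x = a := by
  obtain ⟨e, he⟩ : ∃ e : TangentSpace (𝓡 n) x ≃L[ℝ] EuclideanSpace ℝ (Fin n),
      (e : TangentSpace (𝓡 n) x →L[ℝ] EuclideanSpace ℝ (Fin n)) =
        mfderiv (𝓡 n) 𝓘(ℝ, EuclideanSpace ℝ (Fin n)) (extChartAt (𝓡 n) x) x :=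
    isInvertible_mfderiv_extChartAt (mem_extChartAt_source x)
  obtain ⟨ρ⟩ : Nonempty (SmoothBumpFunction (𝓡 n) x) := inferInstance
  refine ⟨_, isSmooth_bump_smul ρ fun p u hu hx => contDiffAt_inChart_chartPullback hu hx
    (a.compContinuousLinearMap (e.symm : EuclideanSpace ℝ (Fin n) →L[ℝ] TangentSpace (𝓡 n) x)),
    ?_⟩
  ext v
  rw [ρ.eq_one, one_smul, chartPullback, ← he]
  exact congrArg a (funext fun s => e.symm_apply_apply (v s))

end SmoothForms

section Volume

variable {n : ℕ} {M : Type*} [TopologicalSpace M] [ChartedSpace (EuclideanSpace ℝ (Fin n)) M]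
  [IsManifold (𝓡 n) ∞ M]

theorem continuousOn_volDensity (g : Metric n M) (p : M) :
    ContinuousOn (volDensity g p) (extChartAt (𝓡 n) p).target :=
  Real.continuous_sqrt.comp_continuousOn
    (continuous_id.matrix_det.comp_continuousOn (continuousOn_chartGram g p))

theorem volDensity_pos (g : Metric n M) {p : M} {u : EuclideanSpace ℝ (Fin n)}
    (hu : u ∈ (extChartAt (𝓡 n) p).target) : 0 < volDensity g p u :=
  Real.sqrt_pos.2 (posDef_chartGram g p hu).det_pos

theorem tsupport_partition_subset [CompactSpace M] [T2Space M] (p : M) :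
    tsupport (partition n M p) ⊆ (extChartAt (𝓡 n) p).source := by
  rw [extChartAt_source]
  exact Classical.choose_spec
    (SmoothPartitionOfUnity.exists_isSubordinate_chartAt_source (𝓡 n) M) p

variable [MeasurableSpace M] [BorelSpace M]

theorem chartVolume_apply (g : Metric n M) (p : M) {s : Set M} (hs : MeasurableSet s) :
    chartVolume g p s = ∫⁻ u in (extChartAt (𝓡 n) p).target ∩ (extChartAt (𝓡 n) p).symm ⁻¹' s,
      ENNReal.ofReal (volDensity g p u) := by
  have h_target := (isOpen_extChartAt_target (I := 𝓡 n) p).measurableSet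
  have h_symm : AEMeasurable (extChartAt (𝓡 n) p).symm
      (volume.restrict (extChartAt (𝓡 n) p).target) :=
    (continuousOn_extChartAt_symm p).aemeasurable h_target
  rw [chartVolume, Measure.map_apply_of_aemeasurable
    (h_symm.mono_ac (withDensity_absolutelyContinuous _ _)) hs, withDensity_apply',
    Measure.restrict_restrict' h_target, Set.inter_comm]

theorem chartVolume_lt_top (g : Metric n M) (p : M) {s : Set M} (hs : MeasurableSet s)
    (hsc : IsCompact s) (hsub : s ⊆ (extChartAt (𝓡 n) p).source) : chartVolume g p s < ⊤ := by
  have h_image := (extChartAt (𝓡 n) p).image_eq_target_inter_inv_preimage hsub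
  have h_compact : IsCompact (extChartAt (𝓡 n) p '' s) :=
    hsc.image_of_continuousOn ((continuousOn_extChartAt p).mono hsub)
  obtain ⟨C, hC⟩ := h_compact.exists_bound_of_continuousOn
    ((continuousOn_volDensity g p).mono (h_image ▸ Set.inter_subset_left))
  rw [chartVolume_apply g p hs, ← h_image]
  calc ∫⁻ u in extChartAt (𝓡 n) p '' s, ENNReal.ofReal (volDensity g p u)
      ≤ ∫⁻ _ in extChartAt (𝓡 n) p '' s, ENNReal.ofReal C :=
        setLIntegral_mono' h_compact.measurableSet fun u hu =>
          ENNReal.ofReal_le_ofReal ((le_abs_self _).trans (hC u hu))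
    _ = ENNReal.ofReal C * volume (extChartAt (𝓡 n) p '' s) := setLIntegral_const _ _
    _ < ⊤ := ENNReal.mul_lt_top ENNReal.ofReal_lt_top h_compact.measure_lt_top

theorem chartVolume_pos (g : Metric n M) {p : M} {U : Set M} (hU : IsOpen U)
    (hUp : (U ∩ (extChartAt (𝓡 n) p).source).Nonempty) : 0 < chartVolume g p U := by
  set O := (extChartAt (𝓡 n) p).target ∩ (extChartAt (𝓡 n) p).symm ⁻¹' U
  have hO : IsOpen O :=
    (continuousOn_extChartAt_symm p).isOpen_inter_preimage (isOpen_extChartAt_target p) hU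
  have hO_nonempty : O.Nonempty := by
    obtain ⟨x, hxU, hxp⟩ := hUp
    refine ⟨extChartAt (𝓡 n) p x, (extChartAt (𝓡 n) p).map_source hxp, ?_⟩
    rwa [Set.mem_preimage, (extChartAt (𝓡 n) p).left_inv hxp]
  have h_meas : AEMeasurable (fun u => ENNReal.ofReal (volDensity g p u)) (volume.restrict O) :=
    (((continuousOn_volDensity g p).mono Set.inter_subset_left).aemeasurable
      hO.measurableSet).ennreal_ofReal
  rw [chartVolume_apply g p hU.measurableSet, pos_iff_ne_zero, Ne, lintegral_eq_zero_iff' h_meas]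
  intro h_ae
  refine (hO.measure_pos volume hO_nonempty).ne' (measure_eq_zero_iff_ae_notMem.2 ?_)
  filter_upwards [(ae_restrict_iff' hO.measurableSet).1 h_ae] with u hu huO
  exact (ENNReal.ofReal_pos.2 (volDensity_pos g huO.1)).ne' (hu huO)

variable [CompactSpace M] [T2Space M]

theorem lintegral_partition_lt_top (g : Metric n M) (p : M) :
    ∫⁻ x, ENNReal.ofReal (partition n M p x) ∂(chartVolume g p) < ⊤ := by
  have h_closed := isClosed_tsupport (partition n M p)
  have h_le : ∀ x, ENNReal.ofReal (partition n M p x) ≤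
      (tsupport (partition n M p)).indicator 1 x := fun x => by
    by_cases hx : x ∈ tsupport (partition n M p)
    · rw [Set.indicator_of_mem hx]
      exact ENNReal.ofReal_le_one.2 ((partition n M).le_one p x)
    · rw [image_eq_zero_of_notMem_tsupport hx, ENNReal.ofReal_zero]
      exact zero_le
  calc ∫⁻ x, ENNReal.ofReal (partition n M p x) ∂(chartVolume g p)
      ≤ ∫⁻ x, (tsupport (partition n M p)).indicator 1 x ∂(chartVolume g p) := lintegral_mono h_le
    _ = chartVolume g p (tsupport (partition n M p)) :=
        lintegral_indicator_one h_closed.measurableSet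
    _ < ⊤ := chartVolume_lt_top g p h_closed.measurableSet h_closed.isCompact
        (tsupport_partition_subset p)

instance isFiniteMeasure_riemVolume (g : Metric n M) : IsFiniteMeasure (riemVolume g) := by
  refine ⟨?_⟩
  have h_finite := (partition n M).locallyFinite.finite_nonempty_of_compact
  rw [riemVolume, Measure.sum_apply _ MeasurableSet.univ,
    tsum_eq_sum (s := h_finite.toFinset) fun p hp => ?_]
  · refine ENNReal.sum_lt_top.2 fun p _ => ?_
    rw [withDensity_apply _ MeasurableSet.univ, Measure.restrict_univ]
    exact lintegral_partition_lt_top g p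
  · have h_zero : ∀ x, partition n M p x = 0 := fun x => by
      by_contra hx
      exact hp (h_finite.mem_toFinset.2 ⟨x, hx⟩)
    simp only [h_zero, ENNReal.ofReal_zero, withDensity_const, zero_smul, Measure.coe_zero,
      Pi.zero_apply]

instance isOpenPosMeasure_riemVolume (g : Metric n M) :
    (riemVolume g).IsOpenPosMeasure := by
  refine ⟨fun U hU ⟨x, hxU⟩ => ?_⟩
  obtain ⟨p, hp⟩ := (partition n M).exists_pos_of_mem (Set.mem_univ x)
  have h_cont : Continuous (partition n M p) := (partition n M p).contMDiff.continuous
  have h_open : IsOpen ({y | 0 < partition n M p y} ∩ U) :=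
    (isOpen_lt continuous_const h_cont).inter hU
  have h_pos := chartVolume_pos g h_open
    ⟨x, ⟨hp, hxU⟩, tsupport_partition_subset p (subset_tsupport _ hp.ne')⟩
  refine ne_of_gt (lt_of_lt_of_le ?_ (Measure.le_sum _ p U))
  rw [pos_iff_ne_zero, Ne, withDensity_apply_eq_zero h_cont.measurable.ennreal_ofReal]
  simpa only [Ne, ENNReal.ofReal_eq_zero, not_le] using h_pos.ne'

end Volume

section Densities

variable {X : Type*} [MeasurableSpace X]

/-- `f` is a probability density with respect to `μ` which vanishes outside `V`. -/
structure IsDensityOn (μ : Measure X) (V : Set X) (f : X → ℝ) : Prop where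
  nonneg : ∀ y, 0 ≤ f y
  support_subset : Function.support f ⊆ V
  integral_eq_one : ∫ y, f y ∂μ = 1

theorem IsDensityOn.mono {μ : Measure X} {V W : Set X} {f : X → ℝ} (hf : IsDensityOn μ V f)
    (hVW : V ⊆ W) : IsDensityOn μ W f :=
  ⟨hf.nonneg, hf.support_subset.trans hVW, hf.integral_eq_one⟩

theorem IsDensityOn.abs_integral_mul_sub_le {μ : Measure X} {V : Set X} {f h : X → ℝ}
    (hf : IsDensityOn μ V f) (hh : AEStronglyMeasurable h μ) {t δ : ℝ}
    (hδ : ∀ z ∈ V, |h z - t| ≤ δ) : |∫ z, f z * h z ∂μ - t| ≤ δ := by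
  have hf_int : Integrable f μ := integrable_of_integral_eq_one hf.integral_eq_one
  have h_bound : ∀ z, ‖f z * (h z - t)‖ ≤ f z * δ := fun z => by
    rw [norm_mul, Real.norm_of_nonneg (hf.nonneg z), Real.norm_eq_abs]
    by_cases hz : f z = 0
    · rw [hz, zero_mul, zero_mul]
    · exact mul_le_mul_of_nonneg_left (hδ z (hf.support_subset hz)) (hf.nonneg z)
  have h_int : Integrable (fun z => f z * (h z - t)) μ :=
    (hf_int.mul_const δ).mono' (hf_int.aestronglyMeasurable.mul
      (hh.sub aestronglyMeasurable_const)) (Eventually.of_forall h_bound)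
  have h_sub : ∫ z, f z * h z ∂μ - t = ∫ z, f z * (h z - t) ∂μ := by
    have h_const : ∫ z, f z * t ∂μ = t := by rw [integral_mul_const, hf.integral_eq_one, one_mul]
    calc ∫ z, f z * h z ∂μ - t = ∫ z, (f z * (h z - t) + f z * t) ∂μ - t := by
          simp only [mul_sub, sub_add_cancel]
      _ = ∫ z, f z * (h z - t) ∂μ := by
          rw [integral_add h_int (hf_int.mul_const t), h_const, add_sub_cancel_right]
  calc |∫ z, f z * h z ∂μ - t| = ‖∫ z, f z * (h z - t) ∂μ‖ := by rw [h_sub, Real.norm_eq_abs]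
    _ ≤ ∫ z, f z * δ ∂μ :=
        norm_integral_le_of_norm_le (hf_int.mul_const δ) (Eventually.of_forall h_bound)
    _ = δ := by rw [integral_mul_const, hf.integral_eq_one, one_mul]

end Densities

section ApproximateIdentity

variable {E : Type*} [NormedAddCommGroup E] [NormedSpace ℝ E] {H : Type*} [TopologicalSpace H]
  (I : ModelWithCorners ℝ E H) {X : Type*} [TopologicalSpace X] [ChartedSpace H X]
  [MeasurableSpace X]

/-- The filter of the smooth probability densities that concentrate at `x`: a property holds
eventually if it holds for all smooth densities supported in some neighbourhood of `x`. -/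
def deltaFilter (μ : Measure X) (x : X) : Filter (X → ℝ) :=
  (𝓝 x).lift' fun V => {f | ContMDiff I 𝓘(ℝ) ∞ f ∧ IsDensityOn μ V f}

variable {I} {μ : Measure X} {x : X}

theorem eventually_isDensityOn_deltaFilter {V : Set X} (hV : V ∈ 𝓝 x) :
    ∀ᶠ f in deltaFilter I μ x, IsDensityOn μ V f :=
  mem_of_superset (mem_lift' hV) fun _ hf => hf.2

theorem eventually_contMDiff_deltaFilter : ∀ᶠ f in deltaFilter I μ x, ContMDiff I 𝓘(ℝ) ∞ f :=
  mem_of_superset (mem_lift' univ_mem) fun _ hf => hf.1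

theorem tendsto_integral_deltaFilter {h : X → ℝ} (hh : AEStronglyMeasurable h μ)
    (hx : ContinuousAt h x) :
    Tendsto (fun f => ∫ z, f z * h z ∂μ) (deltaFilter I μ x) (𝓝 (h x)) := by
  refine Metric.tendsto_nhds.2 fun ε hε => ?_
  have hV := Metric.tendsto_nhds.1 hx (ε / 2) (half_pos hε)
  filter_upwards [eventually_isDensityOn_deltaFilter hV] with f hf
  exact (hf.abs_integral_mul_sub_le hh fun z hz => le_of_lt hz).trans_lt (half_lt_self hε)

theorem tendsto_double_integral_deltaFilter [OpensMeasurableSpace X] [SFinite μ]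
    {F : X × X → ℝ} (hF : StronglyMeasurable F) (hx : ContinuousAt F (x, x)) :
    Tendsto (fun f => ∫ z, f z * ∫ y, f y * F (z, y) ∂μ ∂μ) (deltaFilter I μ x)
      (𝓝 (F (x, x))) := by
  refine Metric.tendsto_nhds.2 fun ε hε => ?_
  have hV := Metric.tendsto_nhds.1 hx (ε / 2) (half_pos hε)
  rw [nhds_prod_eq, eventually_prod_self_iff'] at hV
  obtain ⟨V, hVx, hV⟩ := hV
  filter_upwards [eventually_isDensityOn_deltaFilter hVx, eventually_contMDiff_deltaFilter]
    with f hf hf_smooth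
  have hf_meas := hf_smooth.continuous.stronglyMeasurable
  have h_inner : StronglyMeasurable fun z => ∫ y, f y * F (z, y) ∂μ :=
    StronglyMeasurable.integral_prod_right' (f := fun q : X × X => f q.2 * F q)
      ((hf_meas.comp_measurable measurable_snd).mul hF)
  refine (hf.abs_integral_mul_sub_le h_inner.aestronglyMeasurable fun z hz => ?_).trans_lt
    (half_lt_self hε)
  exact hf.abs_integral_mul_sub_le (hF.comp_measurable measurable_prodMk_left).aestronglyMeasurable
    fun y hy => le_of_lt (hV z hz y hy)

instance neBot_deltaFilter [FiniteDimensional ℝ E] [IsManifold I ∞ X] [T2Space X]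
    [OpensMeasurableSpace X] [IsFiniteMeasureOnCompacts μ] [μ.IsOpenPosMeasure] :
    (deltaFilter I μ x).NeBot := by
  rw [deltaFilter, lift'_neBot_iff]
  swap
  · exact fun V W hVW f hf => ⟨hf.1, hf.2.mono hVW⟩
  intro V hV
  obtain ⟨ρ, -, hρV⟩ := (SmoothBumpFunction.nhds_basis_support (I := I)
    (univ_mem : Set.univ ∈ 𝓝 x)).mem_iff.1 hV
  have h_pos : 0 < ∫ y, ρ y ∂μ :=
    ρ.continuous.integral_pos_of_hasCompactSupport_nonneg_nonzero ρ.hasCompactSupport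
      (fun _ => ρ.nonneg) (x := x) (by rw [ρ.eq_one]; exact one_ne_zero)
  exact ⟨fun y => (∫ y, ρ y ∂μ)⁻¹ * ρ y, contMDiff_const.mul ρ.contMDiff,
    fun y => mul_nonneg (inv_nonneg.2 h_pos.le) ρ.nonneg,
    (Function.support_mul_subset_right _ _).trans hρV,
    by rw [integral_const_mul, inv_mul_cancel₀ h_pos.ne']⟩

end ApproximateIdentity

section L2Pairing

variable {n k : ℕ} {M : Type*} [TopologicalSpace M] [ChartedSpace (EuclideanSpace ℝ (Fin n)) M]

variable (n k M) in
/-- The space `Ωᵏ(M)` of smooth `k`-forms, on which the `L²` inner product is bilinear. -/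
def smoothForms : Submodule ℝ (Form n k M) where
  carrier := {α | IsSmooth α}
  add_mem' := IsSmooth.add
  zero_mem' := fun _ => contDiffOn_const (c := 0)
  smul_mem' := fun c _ hα => hα.const_smul c

variable [IsManifold (𝓡 n) ∞ M] [CompactSpace M] [T2Space M] [MeasurableSpace M]
  (g : Metric n M) {α β : Form n k M}

theorem l2Inner_eq_integral_formBilin (α β : Form n k M) :
    l2Inner g α β = ∫ x, formBilin g x (α x) (β x) ∂(riemVolume g) := by
  simp only [l2Inner, formInner_eq_formBilin]

theorem l2Inner_comm (α β : Form n k M) : l2Inner g α β = l2Inner g β α := by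
  simp only [l2Inner_eq_integral_formBilin, (formBilin_isSymm g _).eq (α _)]

theorem l2Inner_smul_left (c : ℝ) (α β : Form n k M) :
    l2Inner g (c • α) β = c * l2Inner g α β := by
  simp only [l2Inner_eq_integral_formBilin, Pi.smul_apply, map_smul, LinearMap.smul_apply,
    smul_eq_mul, integral_const_mul]

theorem l2Inner_self_nonneg (α : Form n k M) : 0 ≤ l2Inner g α α := by
  rw [l2Inner_eq_integral_formBilin]
  exact integral_nonneg fun x => formBilin_self_nonneg g x (α x)

variable [BorelSpace M]

theorem integrable_formBilin (hα : IsSmooth α) (hβ : IsSmooth β) :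
    Integrable (fun x => formBilin g x (α x) (β x)) (riemVolume g) :=
  (continuous_formBilin g hα hβ).integrable_of_hasCompactSupport
    (HasCompactSupport.of_compactSpace _)

theorem l2Inner_add_left (hα : IsSmooth α) (hβ : IsSmooth β) {γ : Form n k M} (hγ : IsSmooth γ) :
    l2Inner g (α + β) γ = l2Inner g α γ + l2Inner g β γ := by
  simp only [l2Inner_eq_integral_formBilin, Pi.add_apply, map_add, LinearMap.add_apply]
  exact integral_add (integrable_formBilin g hα hγ) (integrable_formBilin g hβ hγ)

/-- The `L²` inner product, as a bilinear form on the smooth forms. -/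
def l2Bilin : LinearMap.BilinForm ℝ (smoothForms n k M) :=
  LinearMap.mk₂ ℝ (fun α β => l2Inner g α.1 β.1)
    (fun α β γ => l2Inner_add_left g α.2 β.2 γ.2)
    (fun c α β => l2Inner_smul_left g c α.1 β.1)
    (fun α β γ => by
      simpa only [l2Inner_comm g α.1] using! l2Inner_add_left g β.2 γ.2 α.2)
    (fun c α β => by simpa only [l2Inner_comm g α.1] using! l2Inner_smul_left g c β.1 α.1)

theorem l2Inner_sub_left (hα : IsSmooth α) (hβ : IsSmooth β) {γ : Form n k M} (hγ : IsSmooth γ) :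
    l2Inner g (α - β) γ = l2Inner g α γ - l2Inner g β γ := by
  rw [eq_sub_iff_add_eq, ← l2Inner_add_left g ((smoothForms n k M).sub_mem hα hβ) hβ hγ,
    sub_add_cancel]

theorem l2Inner_sq_le (hα : IsSmooth α) (hβ : IsSmooth β) :
    l2Inner g α β ^ 2 ≤ l2Inner g α α * l2Inner g β β := by
  have h_nonneg (γ : smoothForms n k M) : 0 ≤ l2Bilin g γ γ := l2Inner_self_nonneg g γ.1
  have h_symm : LinearMap.IsSymm (l2Bilin (k := k) g) := ⟨fun γ γ' => l2Inner_comm g γ.1 γ'.1⟩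
  exact LinearMap.BilinForm.apply_sq_le_of_symm _ h_nonneg h_symm
    (⟨α, hα⟩ : smoothForms n k M) ⟨β, hβ⟩

end L2Pairing

section Harmonic

variable {n k : ℕ} {M : Type*} [TopologicalSpace M] [ChartedSpace (EuclideanSpace ℝ (Fin n)) M]

theorem extD_const_smul (c : ℝ) (α : Form n k M) : extD (c • α) = c • extD α := by
  funext x
  have h_chart : inChart (c • α) x = c • inChart α x := rfl
  rw [extD, h_chart, extDeriv_smul]
  rfl

variable [IsManifold (𝓡 n) ∞ M] [CompactSpace M] [T2Space M] [MeasurableSpace M]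
  {g : Metric n M}

theorem IsCodifferential.const_smul {α : Form n (k + 1) M} {β : Form n k M}
    (h : IsCodifferential g α β) (c : ℝ) : IsCodifferential g (c • α) (c • β) :=
  ⟨h.1.const_smul c, fun γ hγ => by rw [l2Inner_smul_left, l2Inner_smul_left, h.2 γ hγ]⟩

theorem IsLaplacian.const_smul {α η : Form n k M} (h : IsLaplacian g α η) (c : ℝ) :
    IsLaplacian g (c • α) (c • η) := by
  cases k with
  | zero =>
    have h_codiff : IsCodifferential g (c • extD α) (c • η) := IsCodifferential.const_smul h c
    rwa [← extD_const_smul] at h_codiff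
  | succ k =>
    obtain ⟨β, ζ, hβ, hζ, rfl⟩ := h
    refine ⟨c • β, c • ζ, hβ.const_smul c, ?_, ?_⟩
    · rw [extD_const_smul]
      exact hζ.const_smul c
    · rw [extD_const_smul, smul_add]

theorem IsHarmonic.const_smul {α : Form n k M} (h : IsHarmonic g α) (c : ℝ) :
    IsHarmonic g (c • α) := by
  refine ⟨h.1.const_smul c, ?_⟩
  rw [← smul_zero c]
  exact h.2.const_smul c

theorem sSup_peakValues_nonneg (g : Metric n M) (x : M) : 0 ≤ sSup (peakValues g k x) := by
  refine Real.sSup_nonneg ?_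
  rintro r ⟨α, -, -, rfl⟩
  rw [formInner_eq_formBilin]
  exact formBilin_self_nonneg g x (α x)

theorem formBilin_self_le_sSup_peakValues_of_pos {x : M} (h_bdd : BddAbove (peakValues g k x))
    {η : Form n k M} (hη : IsHarmonic g η) (h_pos : 0 < l2Inner g η η) :
    formBilin g x (η x) (η x) ≤ sSup (peakValues g k x) * l2Inner g η η := by
  set c := (√(l2Inner g η η))⁻¹
  have hc : c * c = (l2Inner g η η)⁻¹ := by rw [← mul_inv, Real.mul_self_sqrt h_pos.le]
  have h_unit : l2Inner g (c • η) (c • η) = 1 := by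
    rw [l2Inner_smul_left, l2Inner_comm, l2Inner_smul_left, ← mul_assoc, hc,
      inv_mul_cancel₀ h_pos.ne']
  have h_peak : (l2Inner g η η)⁻¹ * formBilin g x (η x) (η x) ∈ peakValues g k x := by
    refine ⟨c • η, hη.const_smul c, h_unit, ?_⟩
    rw [formInner_eq_formBilin, Pi.smul_apply, map_smul, map_smul, LinearMap.smul_apply,
      smul_eq_mul, smul_eq_mul, ← mul_assoc, hc]
  rw [mul_comm, ← inv_mul_le_iff₀ h_pos]
  exact le_csSup h_bdd h_peak

end Harmonic

section Kernel

variable {n k : ℕ} {M : Type*} [TopologicalSpace M] [ChartedSpace (EuclideanSpace ℝ (Fin n)) M]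
  [IsManifold (𝓡 n) ∞ M]

/-- The function `(z, y) ↦ ⟨K(z, y) θ(y), θ(z)⟩`. -/
def kernelPairing (g : Metric n M) (K : (x y : M) → FormAt n k y →ₗ[ℝ] FormAt n k x)
    (θ : Form n k M) (q : M × M) : ℝ :=
  formBilin g q.1 (K q.1 q.2 (θ q.2)) (θ q.1)

variable [CompactSpace M] [T2Space M] [MeasurableSpace M] {g : Metric n M}
  {K : (x y : M) → FormAt n k y →ₗ[ℝ] FormAt n k x} {θ : Form n k M}

theorem IsHarmonicKernel.continuous_kernelPairing (hK : IsHarmonicKernel g K) (hθ : IsSmooth θ) :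
    Continuous (kernelPairing g K θ) := by
  simpa only [kernelPairing, formInner_eq_formBilin] using! hK.1 θ θ hθ hθ

theorem IsHarmonicKernel.continuous_dual_apply (hK : IsHarmonicKernel g K) (hθ : IsSmooth θ)
    {z : M} (ℓ : Module.Dual ℝ (FormAt n k z)) : Continuous fun y => ℓ (K z y (θ y)) := by
  obtain ⟨b, hb⟩ :=
    exists_orthonormal_basis (formBilin_isSymm g z) fun a ha => formBilin_self_pos g z ha
  obtain ⟨ξ, hξ, hξz⟩ := exists_isSmooth_apply_eq z (∑ i, ℓ (b i) • b i)
  refine ((hK.1 θ ξ hθ hξ).comp (Continuous.prodMk_right z)).congr fun y => ?_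
  exact (formInner_eq_formBilin g z _ _).trans
    ((congrArg _ hξz).trans (dual_eq_of_orthonormal hb ℓ (K z y (θ y))).symm)

variable [BorelSpace M]

theorem IsHarmonicKernel.dual_eq_integral (hK : IsHarmonicKernel g K) (hθ : IsSmooth θ) {z : M}
    {a : FormAt n k z} (ha : ∀ v, a v = ∫ y, K z y (θ y) v ∂(riemVolume g))
    (ℓ : Module.Dual ℝ (FormAt n k z)) : ℓ a = ∫ y, ℓ (K z y (θ y)) ∂(riemVolume g) := by
  obtain ⟨c, hc⟩ := exists_dual_eq_sum_components (stdBasis z) ℓ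
  have h_int (I : Fin k → Fin n) :
      Integrable (fun y => components (Fin k) (stdBasis z) (K z y (θ y)) I) (riemVolume g) :=
    (hK.continuous_dual_apply hθ ((LinearMap.proj I).comp
      (components (Fin k) (stdBasis z)))).integrable_of_hasCompactSupport
      (HasCompactSupport.of_compactSpace _)
  simp only [hc]
  rw [integral_finsetSum _ fun I _ => (h_int I).mul_const (c I)]
  simp only [integral_mul_const, components_apply, ha]

/-- The integral of `f(z) f(y) ⟨K(z, y) θ(y), θ(z)⟩`; it is the squared `L²` norm of the harmonic
projection of `f θ`. -/
def kernelEnergy (g : Metric n M) (K : (x y : M) → FormAt n k y →ₗ[ℝ] FormAt n k x)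
    (θ : Form n k M) (f : M → ℝ) : ℝ :=
  ∫ z, f z * ∫ y, f y * kernelPairing g K θ (z, y) ∂(riemVolume g) ∂(riemVolume g)

theorem IsHarmonicKernel.exists_projection_smul (hK : IsHarmonicKernel g K) (hθ : IsSmooth θ)
    {f : M → ℝ} (hf : ContMDiff (𝓡 n) 𝓘(ℝ) ∞ f) :
    ∃ η : Form n k M, IsHarmonic g η ∧ l2Inner g η η = kernelEnergy g K θ f ∧
      (∀ h, IsHarmonic g h →
        l2Inner g η h = ∫ z, f z * formBilin g z (θ z) (h z) ∂(riemVolume g)) ∧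
      ∀ z, formBilin g z (η z) (θ z) = ∫ y, f y * kernelPairing g K θ (z, y) ∂(riemVolume g) := by
  have hfθ := hθ.fun_smul hf
  obtain ⟨η, ⟨hη, h_orth⟩, h_formula⟩ := hK.2 _ hfθ
  have h_inner (h : Form n k M) (hh : IsHarmonic g h) :
      l2Inner g η h = ∫ z, f z * formBilin g z (θ z) (h z) ∂(riemVolume g) := by
    have h_sub := h_orth h hh
    rw [l2Inner_sub_left g hfθ hη.1 hh.1, sub_eq_zero] at h_sub
    rw [← h_sub, l2Inner_eq_integral_formBilin]
    simp only [map_smul, LinearMap.smul_apply, smul_eq_mul]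
  have h_eval (z : M) :
      formBilin g z (η z) (θ z) = ∫ y, f y * kernelPairing g K θ (z, y) ∂(riemVolume g) := by
    rw [(formBilin_isSymm g z).eq (η z), hK.dual_eq_integral hfθ (h_formula z)]
    simp only [map_smul, LinearMap.smul_apply, smul_eq_mul, kernelPairing,
      (formBilin_isSymm g z).eq (θ z)]
  refine ⟨η, hη, ?_, h_inner, h_eval⟩
  rw [h_inner η hη, kernelEnergy]
  simp only [← h_eval, (formBilin_isSymm g _).eq (θ _)]

theorem IsHarmonicKernel.tendsto_kernelEnergy (hK : IsHarmonicKernel g K) (hθ : IsSmooth θ)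
    (x : M) : Tendsto (kernelEnergy g K θ) (deltaFilter (𝓡 n) (riemVolume g) x)
      (𝓝 (kernelPairing g K θ (x, x))) := by
  have := ChartedSpace.secondCountable_of_sigmaCompact (EuclideanSpace ℝ (Fin n)) M
  have h_cont := hK.continuous_kernelPairing hθ
  exact tendsto_double_integral_deltaFilter h_cont.stronglyMeasurable h_cont.continuousAt

end Kernel

section Diagonal

variable {n k : ℕ} {M : Type*} [TopologicalSpace M] [ChartedSpace (EuclideanSpace ℝ (Fin n)) M]
  [IsManifold (𝓡 n) ∞ M] [CompactSpace M] [T2Space M] [MeasurableSpace M] [BorelSpace M]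
  {g : Metric n M} {K : (x y : M) → FormAt n k y →ₗ[ℝ] FormAt n k x}

theorem IsHarmonicKernel.formBilin_apply_self_nonneg (hK : IsHarmonicKernel g K) {x : M}
    (a : FormAt n k x) : 0 ≤ formBilin g x (K x x a) a := by
  obtain ⟨θ, hθ, rfl⟩ := exists_isSmooth_apply_eq x a
  refine ge_of_tendsto (hK.tendsto_kernelEnergy hθ x) ?_
  filter_upwards [eventually_contMDiff_deltaFilter] with f hf
  obtain ⟨η, -, h_energy, -⟩ := hK.exists_projection_smul hθ hf
  exact h_energy ▸ l2Inner_self_nonneg g η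

theorem IsHarmonicKernel.formBilin_harmonic_sq_le (hK : IsHarmonicKernel g K) {α : Form n k M}
    (hα : IsHarmonic g α) {x : M} (a : FormAt n k x) :
    formBilin g x (α x) a ^ 2 ≤ formBilin g x (K x x a) a * l2Inner g α α := by
  obtain ⟨θ, hθ, rfl⟩ := exists_isSmooth_apply_eq x a
  rw [(formBilin_isSymm g x).eq (α x)]
  have h_cont := continuous_formBilin g hθ hα.1
  refine le_of_tendsto_of_tendsto ((tendsto_integral_deltaFilter
    (integrable_formBilin g hθ hα.1).aestronglyMeasurable h_cont.continuousAt).pow 2)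
    ((hK.tendsto_kernelEnergy hθ x).mul_const _) ?_
  filter_upwards [eventually_contMDiff_deltaFilter] with f hf
  obtain ⟨η, hη, h_energy, h_inner, -⟩ := hK.exists_projection_smul hθ hf
  rw [← h_inner α hα, ← h_energy]
  exact l2Inner_sq_le g hη.1 hα.1

theorem IsHarmonicKernel.formBilin_self_le_trace (hK : IsHarmonicKernel g K) {α : Form n k M}
    (hα : IsHarmonic g α) (x : M) :
    formBilin g x (α x) (α x) ≤ LinearMap.trace ℝ _ (K x x) * l2Inner g α α := by
  obtain ⟨b, hb⟩ :=
    exists_orthonormal_basis (formBilin_isSymm g x) fun a ha => formBilin_self_pos g x ha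
  rw [self_eq_sum_sq_of_orthonormal hb, trace_eq_sum_of_orthonormal hb, Finset.sum_mul]
  exact Finset.sum_le_sum fun i _ => hK.formBilin_harmonic_sq_le hα (b i)

theorem IsHarmonicKernel.bddAbove_peakValues (hK : IsHarmonicKernel g K) (x : M) :
    BddAbove (peakValues g k x) := by
  refine ⟨LinearMap.trace ℝ _ (K x x), ?_⟩
  rintro r ⟨α, hα, h_norm, rfl⟩
  have h_le := hK.formBilin_self_le_trace hα x
  rwa [h_norm, mul_one, ← formInner_eq_formBilin] at h_le

theorem IsHarmonicKernel.formBilin_self_le_sSup_peakValues (hK : IsHarmonicKernel g K)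
    {η : Form n k M} (hη : IsHarmonic g η) (x : M) :
    formBilin g x (η x) (η x) ≤ sSup (peakValues g k x) * l2Inner g η η := by
  rcases (l2Inner_self_nonneg g η).eq_or_lt with h_zero | h_pos
  · have h_le := hK.formBilin_self_le_trace hη x
    rwa [← h_zero, mul_zero] at h_le ⊢
  · exact formBilin_self_le_sSup_peakValues_of_pos (hK.bddAbove_peakValues x) hη h_pos

theorem IsHarmonicKernel.formBilin_apply_self_le (hK : IsHarmonicKernel g K) {x : M}
    (a : FormAt n k x) :
    formBilin g x (K x x a) a ≤ sSup (peakValues g k x) * formBilin g x a a := by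
  rcases (hK.formBilin_apply_self_nonneg a).eq_or_lt with h_zero | h_pos
  · rw [← h_zero]
    exact mul_nonneg (sSup_peakValues_nonneg g x) (formBilin_self_nonneg g x a)
  refine le_of_mul_le_mul_right ?_ h_pos
  obtain ⟨θ, hθ, rfl⟩ := exists_isSmooth_apply_eq x a
  have h_slice : Continuous fun y => kernelPairing g K θ (x, y) :=
    (hK.continuous_kernelPairing hθ).comp (Continuous.prodMk_right x)
  rw [← sq]
  refine le_of_tendsto_of_tendsto ((tendsto_integral_deltaFilter
    h_slice.aestronglyMeasurable h_slice.continuousAt).pow 2)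
    ((hK.tendsto_kernelEnergy hθ x).const_mul _) ?_
  filter_upwards [eventually_contMDiff_deltaFilter] with f hf
  obtain ⟨η, hη, h_energy, -, h_eval⟩ := hK.exists_projection_smul hθ hf
  calc (∫ y, f y * kernelPairing g K θ (x, y) ∂(riemVolume g)) ^ 2
      = formBilin g x (η x) (θ x) ^ 2 := by rw [h_eval]
    _ ≤ formBilin g x (η x) (η x) * formBilin g x (θ x) (θ x) := formBilin_sq_le g x _ _
    _ ≤ sSup (peakValues g k x) * l2Inner g η η * formBilin g x (θ x) (θ x) :=
        mul_le_mul_of_nonneg_right (hK.formBilin_self_le_sSup_peakValues hη x)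
          (formBilin_self_nonneg g x _)
    _ = sSup (peakValues g k x) * formBilin g x (θ x) (θ x) * kernelEnergy g K θ f := by
        rw [h_energy, mul_right_comm]

theorem IsHarmonicKernel.trace_nonneg (hK : IsHarmonicKernel g K) (x : M) :
    0 ≤ LinearMap.trace ℝ _ (K x x) := by
  obtain ⟨b, hb⟩ :=
    exists_orthonormal_basis (formBilin_isSymm g x) fun a ha => formBilin_self_pos g x ha
  rw [trace_eq_sum_of_orthonormal hb]
  exact Finset.sum_nonneg fun i _ => hK.formBilin_apply_self_nonneg (b i)

theorem IsHarmonicKernel.trace_le_finrank_mul (hK : IsHarmonicKernel g K) (x : M) :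
    LinearMap.trace ℝ _ (K x x) ≤
      Module.finrank ℝ (FormAt n k x) * sSup (peakValues g k x) := by
  obtain ⟨b, hb⟩ :=
    exists_orthonormal_basis (formBilin_isSymm g x) fun a ha => formBilin_self_pos g x ha
  calc LinearMap.trace ℝ _ (K x x)
      = ∑ i, formBilin g x (K x x (b i)) (b i) := trace_eq_sum_of_orthonormal hb _
    _ ≤ ∑ i, sSup (peakValues g k x) * formBilin g x (b i) (b i) :=
        Finset.sum_le_sum fun i _ => hK.formBilin_apply_self_le (b i)
    _ = Module.finrank ℝ (FormAt n k x) * sSup (peakValues g k x) := by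
        simp only [hb, if_true, mul_one, Finset.sum_const, Finset.card_univ, Fintype.card_fin,
          nsmul_eq_mul]

end Diagonal

end

end HarmonicKernel

theorem mainTheorem9 {n k : ℕ} {M : Type*} [TopologicalSpace M]
    [ChartedSpace (EuclideanSpace ℝ (Fin n)) M] [IsManifold (𝓡 n) ∞ M]
    [CompactSpace M] [T2Space M] [MeasurableSpace M] [BorelSpace M]
    (g : HarmonicKernel.Metric n M)
    (K : (x y : M) → HarmonicKernel.FormAt n k y →ₗ[ℝ] HarmonicKernel.FormAt n k x)
    (hK : HarmonicKernel.IsHarmonicKernel g K) (x : M) :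
    BddAbove (HarmonicKernel.peakValues g k x) ∧
      0 ≤ LinearMap.trace ℝ (HarmonicKernel.FormAt n k x) (K x x) ∧
      LinearMap.trace ℝ (HarmonicKernel.FormAt n k x) (K x x) ≤
        (n.choose k : ℝ) * sSup (HarmonicKernel.peakValues g k x) := by
  have h_choose : (Module.finrank ℝ (HarmonicKernel.FormAt n k x) : ℝ) ≤ n.choose k :=
    Nat.cast_le.2 (HarmonicKernel.finrank_formAt_le x)
  exact ⟨hK.bddAbove_peakValues x, hK.trace_nonneg x, (hK.trace_le_finrank_mul x).trans
    (mul_le_mul_of_nonneg_right h_choose (HarmonicKernel.sSup_peakValues_nonneg g x))⟩
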